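/- Let $a\ge 2$, $b\ge 1$ be integers, $d=a+b$, and let $S=\mathbb C[x,y,z]$. Consider the plane curve $$C:\ f=x^d+x^ay^b+y^{d-1}z=0\quad\text{in }\mathbb P^2_{\mathbb C}.$$ For a form $f\in S$ of degree $d$ defining a reduced curve, let $J_f=(f_x,f_y,f_z)$, let $I_f$ be the saturation of $J_f$ with respect to $(x,y,z)$, let $N(f)=I_f/J_f$, and let $AR(f)\subset S^3$ be the graded module of all triples $(r_0,r_1,r_2)$ with $r_0f_x+r_1f_y+r_2f_z=0$. The curve is *free with exponents* $d_1\le d_2$ if $AR(f)\cong S(-d_1)\oplus S(-d_2)$. It is *nearly free* if $N(f)\ne 0$ and $\dim_{\mathbb C} N(f)_k\le 1$ for all $k$; its *exponents* are then the integers $d_1\le d_2$ such that $S/J_f$ has a graded minimal free resolution of the form $$0\to S(-d-d_2)\to S(-d-d_1+1)\oplus S(-d-d_2+1)^2\to S(-d+1)^3\to S.$$ Then $C$ is a rational cuspidal curve (irreducible, rational, with only unibranch singularities), and: 1. if $a<b$, then $C$ is free with exponents $(a,b-1)$; 2. if $a\ge b$, then $C$ is nearly free, with exponents $(b+1,a-1)$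 if $a\ge b+2$, and $(b,a)$ if $b\le a\le b+1$. -/

import Mathlib

/-!  Plane projective curves `f = 0` over `ℂ`, with `f` in the graded polynomial ring
`S = ℂ[x, y, z]`, where `x = X 0`, `y = X 1`, `z = X 2`. -/

open MvPolynomial

noncomputable section

namespace PlaneCurve

/-- The graded polynomial ring `S = ℂ[x, y, z]`. -/
abbrev S : Type := MvPolynomial (Fin 3) ℂ

/-- `f = 0` is a reduced curve in the projective plane: `f` is homogeneous of positive degree
and has no multiple factor. -/
def IsReducedCurve (f : S) : Prop :=
  (∃ d : ℕ, 0 < d ∧ f.IsHomogeneous d) ∧ Squarefree f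

/-- The `S`-linear map `S³ → S`, `(r₀, r₁, r₂) ↦ r₀ f_x + r₁ f_y + r₂ f_z`. -/
def gradientMap (f : S) : (Fin 3 → S) →ₗ[S] S :=
  Fintype.linearCombination S (fun i => pderiv i f)

/-- The `S`-module `AR(f)` of the Jacobian syzygies of `f`, that is, of all triples
`(r₀, r₁, r₂)` with `r₀ f_x + r₁ f_y + r₂ f_z = 0`. -/
def syzygies (f : S) : Submodule S (Fin 3 → S) :=
  LinearMap.ker (gradientMap f)

/-- A triple of polynomials is homogeneous of degree `m` if all its entries are. -/
def IsHomogeneousTriple (r : Fin 3 → S) (m : ℕ) : Prop :=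
  ∀ i, (r i).IsHomogeneous m

/-- The reduced curve `f = 0` is free with exponents `d₁ ≤ d₂`: the graded module `AR(f)` is
free with a homogeneous basis of degrees `d₁, d₂`, i.e. `AR(f) ≅ S(-d₁) ⊕ S(-d₂)`. -/
def IsFreeWithExponents (f : S) (d₁ d₂ : ℕ) : Prop :=
  IsReducedCurve f ∧ d₁ ≤ d₂ ∧
    ∃ B : Module.Basis (Fin 2) S (syzygies f),
      IsHomogeneousTriple (B 0 : Fin 3 → S) d₁ ∧ IsHomogeneousTriple (B 1 : Fin 3 → S) d₂

/-- The Jacobian ideal `J_f = (f_x, f_y, f_z)`. -/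
def jacobianIdeal (f : S) : Ideal S :=
  Ideal.span (Set.range fun i : Fin 3 => pderiv i f)

/-- The maximal ideal `(x, y, z)`. -/
def irrelevantIdeal : Ideal S :=
  Ideal.span (Set.range fun i : Fin 3 => (X i : S))

/-- The saturation `I_f` of the Jacobian ideal with respect to `(x, y, z)`: all `g` with
`(x, y, z)ⁿ g ⊆ J_f` for some `n`. -/
def saturatedJacobianIdeal (f : S) : Ideal S where
  carrier := {g | ∃ n : ℕ, ∀ h ∈ irrelevantIdeal ^ n, h * g ∈ jacobianIdeal f}
  zero_mem' := ⟨0, fun h _ => by simp⟩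
  add_mem' := by
    rintro g₁ g₂ ⟨n₁, h₁⟩ ⟨n₂, h₂⟩
    refine ⟨max n₁ n₂, fun h hh => ?_⟩
    rw [mul_add]
    exact add_mem (h₁ h (Ideal.pow_le_pow_right (le_max_left _ _) hh))
      (h₂ h (Ideal.pow_le_pow_right (le_max_right _ _) hh))
  smul_mem' := by
    rintro c g ⟨n, hn⟩
    refine ⟨n, fun h hh => ?_⟩
    rw [smul_eq_mul, mul_left_comm]
    exact Ideal.mul_mem_left _ c (hn h hh)

/-- The degree `k` homogeneous part of an ideal, a complex vector space. -/
def homogeneousPart (I : Ideal S) (k : ℕ) : Submodule ℂ S :=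
  I.restrictScalars ℂ ⊓ homogeneousSubmodule (Fin 3) ℂ k

/-- `n(f)_k = dim N(f)_k`, where `N(f) = I_f / J_f`. The vector spaces involved are
finite-dimensional, since there are finitely many monomials of degree `k`. -/
def nDim (f : S) (k : ℕ) : ℕ :=
  Module.finrank ℂ
    (homogeneousPart (saturatedJacobianIdeal f) k ⧸
      (homogeneousPart (jacobianIdeal f) k).submoduleOf
        (homogeneousPart (saturatedJacobianIdeal f) k))

/-- The reduced curve `f = 0` is nearly free: `N(f) ≠ 0` and `n(f)_k ≤ 1` for every `k`. -/
def IsNearlyFree (f : S) : Prop :=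
  IsReducedCurve f ∧ saturatedJacobianIdeal f ≠ jacobianIdeal f ∧ ∀ k, nDim f k ≤ 1

/-- The exponents of a nearly free curve are `d₁ ≤ d₂`: the Milnor algebra `S / J_f` has, with
`d = deg f`, a graded minimal free resolution
`0 → S(-d-d₂) → S(-d-d₁+1) ⊕ S(-d-d₂+1)² → S(-d+1)³ → S`.
Here `r 0, r 1, r 2` are the columns of the second map, which generate `AR(f)` and have degrees
`d₁, d₂, d₂`, and `ρ` is the column of the first map, which generates freely the module of
relations between the `r j`. All entries of the maps have positive degree, so that the
resolution is minimal. -/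
def HasNearlyFreeExponents (f : S) (d₁ d₂ : ℕ) : Prop :=
  0 < d₁ ∧ d₁ ≤ d₂ ∧
    ∃ (r : Fin 3 → Fin 3 → S) (ρ : Fin 3 → S),
      IsHomogeneousTriple (r 0) d₁ ∧ IsHomogeneousTriple (r 1) d₂ ∧
      IsHomogeneousTriple (r 2) d₂ ∧
      Submodule.span S (Set.range r) = syzygies f ∧
      (ρ 0).IsHomogeneous (d₂ + 1 - d₁) ∧ (ρ 1).IsHomogeneous 1 ∧ (ρ 2).IsHomogeneous 1 ∧
      ρ ≠ 0 ∧
      LinearMap.ker (Fintype.linearCombination S r) = Submodule.span S {ρ}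

/-- The curve `f = 0` is nearly free with exponents `d₁ ≤ d₂`. -/
def IsNearlyFreeWithExponents (f : S) (d₁ d₂ : ℕ) : Prop :=
  IsNearlyFree f ∧ HasNearlyFreeExponents f d₁ d₂

/-- The point of the cone `ℂ³` given by a triple of forms in two variables at `s`. -/
def evalTriple (p : Fin 3 → MvPolynomial (Fin 2) ℂ) (s : Fin 2 → ℂ) : Fin 3 → ℂ :=
  fun i => eval s (p i)

/-- The curve `C : f = 0` is rational and cuspidal: it is irreducible, and there is a morphism
`ℙ¹ → ℙ²`, given by a triple `p` of forms of the same degree without common zeros, that maps `ℙ¹`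
bijectively and birationally onto `C`. Such a morphism is the normalization of `C`: its
existence with birationality says that `C` is rational, and its injectivity says that all
singularities of `C` are unibranch. The birational inverse is given by a pair `q` of forms.
Points of `ℙ¹` and `ℙ²` are nonzero vectors up to scalars. -/
def IsRationalCuspidal (f : S) : Prop :=
  (∃ d : ℕ, f.IsHomogeneous d) ∧ Irreducible f ∧
    ∃ (m : ℕ) (p : Fin 3 → MvPolynomial (Fin 2) ℂ),
      (∀ i, (p i).IsHomogeneous m) ∧
      (∀ s, s ≠ 0 → evalTriple p s ≠ 0) ∧
      (∀ s, s ≠ 0 → eval (evalTriple p s) f = 0) ∧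
      (∀ v : Fin 3 → ℂ, v ≠ 0 → eval v f = 0 →
        ∃ s, s ≠ 0 ∧ ∃ c : ℂ, evalTriple p s = c • v) ∧
      (∀ s t, s ≠ 0 → t ≠ 0 → (∃ c : ℂ, evalTriple p s = c • evalTriple p t) →
        ∃ c : ℂ, s = c • t) ∧
      (∃ (k : ℕ) (q : Fin 2 → S),
        (∀ j, (q j).IsHomogeneous k) ∧
        (∃ j, bind₁ p (q j) ≠ 0) ∧
        bind₁ p (q 0) * X 1 = bind₁ p (q 1) * X 0)

/-- The form `x^d + x^a y^b + y^(d-1) z`. -/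
def curveForm (a b d : ℕ) : S :=
  X 0 ^ d + X 0 ^ a * X 1 ^ b + X 1 ^ (d - 1) * X 2

end PlaneCurve

end

open MvPolynomial

noncomputable section

namespace PlaneCurve

/-! The curve is linear in $z$, so it is irreducible, and solving for $z$ gives a bijective
parametrization whose inverse is $(x:y)$.

For the algebra, write $f_y = y^{b-1}g$ with $g = bx^a+(d-1)y^{a-1}z$, and $f_z = y^{b-1}y^a$.
Modulo $y$, $f_x$ is a nonzero multiple of $x^{d-1}$, hence prime to $y$. So $y^{b-1}$ divides the
first entry of every syzygy, and $J_f : y^{b-1} = (f_x, g, y^a)$. If $a<b$, then $f_x\in(g,y^a)$: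
some syzygy has first entry a nonzero constant times $y^{b-1}$, and with $(0,y^a,-g)$ it forms a
basis (`isFreeWithExponents`).

If $a\ge b$, one runs a Euclidean algorithm in $x$: subtract a multiple of $g$ from $f_x$ to cancel
the top power of $x$, then factor out a power of $y$. For $a\le b+1$ one division ends at $(y,\
x^a,\ x^{b-1}(z-\lambda x))$; for $a\ge b+2$ a second one ends at $(y,\ x^{a-1},\ x^bz)$. Each
division passes to a colon ideal by a power of $y$ without losing $z$-torsion (`Linked`,
`linked_span`), so $N(f)$ is generated by a power of $y$ times $w=x^{b-1}$, respectively $x^b$. As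
$w$ is killed by $y$, by a linear form $z-\lambda x$ and by a power of $x$, each degree of $N(f)$
has dimension at most one (`isNearlyFree_of_generator`).

The same divisions turn syzygies of $f$ into syzygies of the final three generators. Modulo $y$
these are two forms with a single syzygy, whence three generators and one relation. -/

/-- A polynomial is congruent to its value under a substitution, modulo every ideal that
contains the differences between the variables and their substitutes. -/
theorem sub_aeval_mem (K : Ideal S) (g : Fin 3 → S) (h : ∀ i, X i - g i ∈ K) (p : S) :
    p - aeval g p ∈ K := by
  induction p using MvPolynomial.induction_on with
  | C c => simp [MvPolynomial.algebraMap_eq]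
  | add p q hp hq =>
    have := K.add_mem hp hq
    rw [map_add]
    convert this using 1
    ring
  | mul_X p i hp =>
    have := K.add_mem (K.mul_mem_right (X i) hp) (K.mul_mem_left (aeval g p) (h i))
    rw [map_mul, aeval_X]
    convert this using 1
    ring

/-! ### Reduction modulo $y$. -/

/-- The substitution `y = 0`. -/
def killY : S →ₐ[ℂ] S := aeval ![X 0, 0, X 2]

@[simp] theorem killY_X0 : killY (X 0) = X 0 := by simp [killY]

@[simp] theorem killY_X1 : killY (X 1) = 0 := by simp [killY]

@[simp] theorem killY_X2 : killY (X 2) = X 2 := by simp [killY]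

@[simp] theorem killY_C (c : ℂ) : killY (C c) = C c := by
  simp [killY, MvPolynomial.algebraMap_eq]

theorem exists_eq_killY_add (p : S) : ∃ u, p = killY p + X 1 * u := by
  have h : p - killY p ∈ Ideal.span {(X 1 : S)} := by
    apply sub_aeval_mem
    intro i
    fin_cases i <;> simp
  obtain ⟨u, hu⟩ := Ideal.mem_span_singleton.1 h
  exact ⟨u, by rw [← hu]; ring⟩

theorem killY_of_X1_dvd {p : S} (h : (X 1 : S) ∣ p) : killY p = 0 := by
  obtain ⟨u, rfl⟩ := h
  simp

theorem X1_pow_dvd_of_mul {F p : S} (hF : killY F ≠ 0) {m : ℕ} (h : (X 1 : S) ^ m ∣ p * F) :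
    (X 1 : S) ^ m ∣ p :=
  (X_prime (i := (1 : Fin 3)) (R := ℂ)).pow_dvd_of_dvd_mul_right m
    (fun h' => hF (killY_of_X1_dvd h')) h

theorem X0_pow_dvd_of_mul {F p : S} (hF : ¬ (X 0 : S) ∣ F) {m : ℕ} (h : (X 0 : S) ^ m ∣ p * F) :
    (X 0 : S) ^ m ∣ p :=
  (X_prime (i := (0 : Fin 3)) (R := ℂ)).pow_dvd_of_dvd_mul_right m hF h

theorem X0_not_dvd_X2_pow (n : ℕ) : ¬ (X 0 : S) ∣ X 2 ^ n := by
  intro h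
  have := (X_prime (i := (0 : Fin 3)) (R := ℂ)).dvd_of_dvd_pow h
  rw [X_dvd_X] at this
  simp at this

theorem C_mul_X0_pow_ne_zero {c : ℂ} (hc : c ≠ 0) (e : ℕ) : (C c * X 0 ^ e : S) ≠ 0 :=
  mul_ne_zero (by simpa using hc) (pow_ne_zero _ (X_ne_zero _))

theorem mem_span_three {F G H u : S} :
    u ∈ Ideal.span {F, G, H} ↔ ∃ α β γ, u = α * F + β * G + γ * H := by
  rw [Ideal.span, Submodule.mem_span_triple]
  simp [eq_comm]

/-- `z` is a nonzerodivisor modulo `(F, yᵐ)` if `F` is monic in `x` modulo `y`. -/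
theorem mem_of_X2_pow_mul_mem {F : S} {c : ℂ} {e : ℕ} (hc : c ≠ 0) (hF : killY F = C c * X 0 ^ e)
    (n : ℕ) (m : ℕ) : ∀ g : S, (∃ α β, X 2 ^ n * g = α * F + β * X 1 ^ m) →
      ∃ α β, g = α * F + β * X 1 ^ m := by
  have hF0 : killY F ≠ 0 := hF ▸ C_mul_X0_pow_ne_zero hc e
  induction m with
  | zero => exact fun g _ => ⟨0, g, by simp⟩
  | succ m ih =>
    rintro g ⟨α, β, h⟩
    obtain ⟨α', g', rfl⟩ := ih g ⟨α, β * X 1, by rw [h]; ring⟩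
    -- Since $y$ is prime to $F$, the factor $y^m$ cancels and the claim descends to $g'$ modulo
    -- $(F, y)$, where $F$ is $cx^e$ and $z$ is prime to $x$.
    obtain ⟨s, hs⟩ : (X 1 : S) ^ m ∣ (α - X 2 ^ n * α') :=
      X1_pow_dvd_of_mul hF0 ⟨X 2 ^ n * g' - β * X 1, by linear_combination -h⟩
    have h1 : X 2 ^ n * g' = s * F + β * X 1 := by
      apply mul_left_cancel₀ (pow_ne_zero m (X_ne_zero (1 : Fin 3)) : (X 1 : S) ^ m ≠ 0)
      linear_combination h + F * hs
    have h2 := congrArg killY h1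
    simp only [map_mul, map_pow, map_add, killY_X2, killY_X1, mul_zero, add_zero, hF] at h2
    obtain ⟨t, ht⟩ : (X 0 : S) ^ e ∣ killY g' :=
      X0_pow_dvd_of_mul (X0_not_dvd_X2_pow n) ⟨killY s * C c, by linear_combination h2⟩
    obtain ⟨u, hu⟩ := exists_eq_killY_add g'
    obtain ⟨v, hv⟩ := exists_eq_killY_add F
    have hcc : (C c⁻¹ * C c : S) = 1 := by rw [← C_mul, inv_mul_cancel₀ hc, C_1]
    refine ⟨α' + X 1 ^ m * (C c⁻¹ * t), u - C c⁻¹ * t * v, ?_⟩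
    rw [hF] at hv
    linear_combination X 1 ^ m * hu + X 1 ^ m * ht - X 1 ^ m * C c⁻¹ * t * hv
      - X 1 ^ m * t * X 0 ^ e * hcc

/-! ### Colon ideals by powers of $y$ and $z$-torsion. -/

/-- `K` is the colon ideal `J : yᵐ`, and the `z`-torsion of `S / J` lies in the image of the
multiplication by `yᵐ`. -/
def Linked (J K : Ideal S) (m : ℕ) : Prop :=
  (∀ u, X 1 ^ m * u ∈ J ↔ u ∈ K) ∧
    ∀ (n : ℕ) (g : S), X 2 ^ n * g ∈ J → ∃ u, g - X 1 ^ m * u ∈ J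

theorem Linked.trans {J K L : Ideal S} {m m' : ℕ} (h : Linked J K m) (h' : Linked K L m') :
    Linked J L (m + m') := by
  refine ⟨fun u => by rw [pow_add, mul_assoc, h.1, h'.1], fun n g hg => ?_⟩
  obtain ⟨u, hu⟩ := h.2 n g hg
  have h1 : X 2 ^ n * u ∈ K := by
    rw [← h.1]
    have := J.sub_mem hg (J.mul_mem_left (X 2 ^ n) hu)
    convert this using 1
    ring
  obtain ⟨v, hv⟩ := h'.2 n u h1
  refine ⟨v, ?_⟩
  have := J.add_mem hu ((h.1 _).2 hv)
  convert this using 1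
  ring

/-- Since $y$ is prime to $F$, powers of $y$ cancel in the colon. The torsion claim holds because
the first ideal lies in $(F, y^m)$, modulo which $z$ is a nonzerodivisor. -/
theorem linked_span {F : S} {c : ℂ} {e : ℕ} (hc : c ≠ 0) (hF : killY F = C c * X 0 ^ e)
    (G H : S) (m : ℕ) :
    Linked (Ideal.span {F, X 1 ^ m * G, X 1 ^ m * H}) (Ideal.span {F, G, H}) m := by
  have hF0 : killY F ≠ 0 := hF ▸ C_mul_X0_pow_ne_zero hc e
  refine ⟨fun u => ?_, fun n g hg => ?_⟩
  · rw [mem_span_three, mem_span_three]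
    constructor
    · rintro ⟨α, β, γ, h⟩
      obtain ⟨s, rfl⟩ : (X 1 : S) ^ m ∣ α :=
        X1_pow_dvd_of_mul hF0 ⟨u - β * G - γ * H, by linear_combination -h⟩
      refine ⟨s, β, γ, ?_⟩
      apply mul_left_cancel₀ (pow_ne_zero m (X_ne_zero (1 : Fin 3)) : (X 1 : S) ^ m ≠ 0)
      linear_combination h
    · rintro ⟨α, β, γ, rfl⟩
      exact ⟨X 1 ^ m * α, β, γ, by ring⟩
  · obtain ⟨α, β, γ, h⟩ := mem_span_three.1 hg
    obtain ⟨α', u, hu⟩ := mem_of_X2_pow_mul_mem hc hF n m g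
      ⟨α, β * G + γ * H, by rw [h]; ring⟩
    exact ⟨u, mem_span_three.2 ⟨α', 0, 0, by rw [hu]; ring⟩⟩

theorem jacobianIdeal_eq (f : S) :
    jacobianIdeal f = Ideal.span {pderiv 0 f, pderiv 1 f, pderiv 2 f} := by
  rw [jacobianIdeal]
  congr 1
  ext u
  simp [Fin.exists_fin_succ, eq_comm]

/-! ### A criterion for near freeness. -/

/-- The homogeneous components of a multiple of a form `w` are multiples of `w` by forms. -/
theorem homogeneousComponent_mul {w : S} {e : ℕ} (hw : w.IsHomogeneous e) (s : S) (k : ℕ) :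
    ∃ t : S, (∃ l, t.IsHomogeneous l ∧ (t ≠ 0 → l + e = k)) ∧
      homogeneousComponent k (s * w) = t * w := by
  let : GradedAlgebra (homogeneousSubmodule (Fin 3) ℂ) := gradedAlgebra
  have hdec : ∀ (g : S) (i : ℕ), ((DirectSum.decompose (homogeneousSubmodule (Fin 3) ℂ) g i :
      homogeneousSubmodule (Fin 3) ℂ i) : S) = homogeneousComponent i g :=
    fun g i => decomposition.decompose'_apply g i
  by_cases h : e ≤ k
  · refine ⟨homogeneousComponent (k - e) s, ⟨k - e, homogeneousComponent_isHomogeneous _ _,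
      fun _ => by omega⟩, ?_⟩
    have := DirectSum.coe_decompose_mul_of_right_mem_of_le (homogeneousSubmodule (Fin 3) ℂ)
      (a := s) (b := w) (n := k) (i := e) hw h
    rwa [hdec, hdec] at this
  · refine ⟨0, ⟨0, isHomogeneous_zero _ _ _, by simp⟩, ?_⟩
    have := DirectSum.coe_decompose_mul_of_right_mem_of_not_le (homogeneousSubmodule (Fin 3) ℂ)
      (a := s) (b := w) (n := k) (i := e) hw h
    rwa [hdec, ← zero_mul w] at this

/-- The restriction of a form to the line through the origin and the point `v`. -/
theorem aeval_C_mul_X0 {t : S} {i : ℕ} (ht : t.IsHomogeneous i) (v : Fin 3 → ℂ) :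
    aeval (fun j => (C (v j) * X 0 : S)) t = C (eval v t) * X 0 ^ i := by
  rw [aeval_def, eval₂_eq, eval_eq, map_sum, Finset.sum_mul]
  refine Finset.sum_congr rfl fun m hm => ?_
  have hdeg : m.degree = i := by
    by_contra h
    exact mem_support_iff.1 hm (ht.coeff_eq_zero h)
  have h1 : ∏ j ∈ m.support, (C (v j) * X 0 : S) ^ m j
      = (∏ j ∈ m.support, (C (v j) : S) ^ m j) * X 0 ^ i := by
    simp_rw [mul_pow]
    rw [Finset.prod_mul_distrib, Finset.prod_pow_eq_pow_sum, ← hdeg]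
    rfl
  rw [h1, MvPolynomial.algebraMap_eq, C_mul, map_prod]
  simp_rw [C_pow]
  ring

theorem homogeneousComponent_mem_jacobianIdeal {f : S} {d : ℕ} (hf : f.IsHomogeneous d) {g : S}
    (hg : g ∈ jacobianIdeal f) (k : ℕ) : homogeneousComponent k g ∈ jacobianIdeal f := by
  rw [jacobianIdeal_eq, mem_span_three] at hg
  obtain ⟨α, β, γ, rfl⟩ := hg
  obtain ⟨s, -, hs⟩ := homogeneousComponent_mul (hf.pderiv (i := 0)) α k
  obtain ⟨t, -, ht⟩ := homogeneousComponent_mul (hf.pderiv (i := 1)) β k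
  obtain ⟨u, -, hu⟩ := homogeneousComponent_mul (hf.pderiv (i := 2)) γ k
  rw [map_add, map_add, hs, ht, hu, jacobianIdeal_eq, mem_span_three]
  exact ⟨s, t, u, rfl⟩

/-- A criterion for near freeness: the saturation of the Jacobian ideal `J` is generated by `J`
and a form `w`, whose annihilator modulo `J` contains `y`, `z - λx` and a power of `x`. -/
theorem isNearlyFree_of_generator {f w : S} {e : ℕ} (hf : IsReducedCurve f)
    (hw : w.IsHomogeneous e) (hwJ : w ∉ jacobianIdeal f) (hy : X 1 * w ∈ jacobianIdeal f) (l : ℂ)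
    (hz : (X 2 - C l * X 0) * w ∈ jacobianIdeal f) (j : ℕ) (hx : X 0 ^ j * w ∈ jacobianIdeal f)
    (hsat : ∀ n g, X 2 ^ n * g ∈ jacobianIdeal f → ∃ s, g - s * w ∈ jacobianIdeal f) :
    IsNearlyFree f := by
  set J := jacobianIdeal f with hJ
  let K : Ideal S := J.colon {w}
  have hK : ∀ s, s ∈ K ↔ s * w ∈ J := fun s => by
    simp [K, Submodule.mem_colon_singleton]
  have hwI : w ∈ saturatedJacobianIdeal f := by
    -- The annihilator `K` of $w$ modulo $J$ contains $y$, $z-lx$ and $x^j$, so its radical contains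
    -- all three variables.
    have hrad : irrelevantIdeal ≤ K.radical := by
      rw [irrelevantIdeal, Ideal.span_le]
      have h0 : (X 0 : S) ∈ K.radical := ⟨j, (hK _).2 hx⟩
      rintro _ ⟨i, rfl⟩
      fin_cases i
      · exact h0
      · exact Ideal.le_radical ((hK _).2 hy)
      · have := K.radical.add_mem (Ideal.le_radical ((hK _).2 hz)) (K.radical.mul_mem_left (C l) h0)
        simpa using this
    obtain ⟨n, hn⟩ := Ideal.exists_pow_le_of_le_radical_of_fg hrad (IsNoetherian.noetherian _)
    exact ⟨n, fun h hh => (hK _).1 (hn hh)⟩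
  refine ⟨hf, fun h => hwJ ?_, fun k => ?_⟩
  · rwa [h] at hwI
  obtain ⟨⟨d, -, hd⟩, -⟩ := hf
  have key : ∀ g ∈ saturatedJacobianIdeal f, g.IsHomogeneous k →
      g ∈ J ∨ e ≤ k ∧ ∃ c : ℂ, g - C c * (X 0 ^ (k - e) * w) ∈ J := by
    rintro g ⟨n, hn⟩ hg
    obtain ⟨s, hs⟩ := hsat n g (hn _ (Ideal.pow_mem_pow
      (Ideal.subset_span (Set.mem_range_self (2 : Fin 3))) n))
    have h1 := homogeneousComponent_mem_jacobianIdeal hd hs k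
    obtain ⟨t, ⟨i, hti, hi⟩, ht⟩ := homogeneousComponent_mul hw s k
    rw [map_sub, homogeneousComponent_eq_self hg, ht] at h1
    by_cases ht0 : t = 0
    · exact Or.inl (by simpa [ht0] using h1)
    have hie := hi ht0
    -- Modulo `K`, $t$ may be replaced by its restriction to the line through $(1,0,l)$, a scalar
    -- times a power of $x$.
    have h2 : t - aeval (fun j => (C (![1, 0, l] j) * X 0 : S)) t ∈ K := by
      apply sub_aeval_mem
      intro i
      fin_cases i
      · simp
      · simpa using (hK _).2 hy
      · simpa using (hK _).2 hz
    refine Or.inr ⟨by omega, eval ![1, 0, l] t, ?_⟩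
    have h4 := J.add_mem h1 ((hK _).1 h2)
    rw [aeval_C_mul_X0 hti, show i = k - e by omega] at h4
    convert h4 using 1
    ring
  unfold nDim
  by_cases hek : e ≤ k
  · have hv : X 0 ^ (k - e) * w ∈ homogeneousPart (saturatedJacobianIdeal f) k := by
      refine ⟨Ideal.mul_mem_left _ _ hwI, ?_⟩
      have := (isHomogeneous_X_pow (R := ℂ) (0 : Fin 3) (k - e)).mul hw
      rwa [Nat.sub_add_cancel hek] at this
    refine finrank_le_one (Submodule.Quotient.mk ⟨_, hv⟩) fun q => ?_
    obtain ⟨⟨g, hgI, hgk⟩, rfl⟩ := Submodule.Quotient.mk_surjective _ q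
    have : ∃ c : ℂ, g - C c * (X 0 ^ (k - e) * w) ∈ J := by
      rcases key g hgI hgk with h | ⟨-, h⟩
      · exact ⟨0, by simpa using h⟩
      · exact h
    obtain ⟨c, hc⟩ := this
    refine ⟨c, ?_⟩
    rw [← Submodule.Quotient.mk_smul, eq_comm, Submodule.Quotient.eq]
    rw [Submodule.submoduleOf, Submodule.mem_comap]
    have h5 : (g - C c * (X 0 ^ (k - e) * w)).IsHomogeneous k :=
      IsHomogeneous.sub hgk (IsHomogeneous.C_mul hv.2 c)
    have h6 : g - C c * (X 0 ^ (k - e) * w) ∈ homogeneousPart J k := ⟨hc, h5⟩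
    simpa [smul_eq_C_mul] using h6
  · refine finrank_le_one 0 fun q => ⟨0, ?_⟩
    obtain ⟨⟨g, hgI, hgk⟩, rfl⟩ := Submodule.Quotient.mk_surjective _ q
    rw [smul_zero, eq_comm, Submodule.Quotient.mk_eq_zero, Submodule.submoduleOf,
      Submodule.mem_comap]
    rcases key g hgI hgk with h | ⟨h, -⟩
    · exact ⟨h, hgk⟩
    · exact absurd h hek

/-! ### Irreducibility and the parametrization. -/

theorem isHomogeneous_curveForm {a b d : ℕ} (hb : 1 ≤ b) (hd : a + b = d) :
    (curveForm a b d).IsHomogeneous d := by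
  have h2 := (isHomogeneous_X_pow (R := ℂ) (0 : Fin 3) a).mul
    (isHomogeneous_X_pow (R := ℂ) (1 : Fin 3) b)
  have h3 := (isHomogeneous_X_pow (R := ℂ) (1 : Fin 3) (d - 1)).mul
    (isHomogeneous_X ℂ (2 : Fin 3))
  rw [hd] at h2
  rw [show d - 1 + 1 = d by omega] at h3
  exact ((isHomogeneous_X_pow _ _).add h2).add h3

/-- The form is linear in $z$, and its coefficients $y^{d-1}$ and $x^d+x^ay^b$ are coprime: as
$b\ge1$, $y$ does not divide the second. -/
theorem irreducible_curveForm {a b d : ℕ} (hb : 1 ≤ b) (hd : a + b = d) :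
    Irreducible (curveForm a b d) := by
  have h : curveForm a b d = X 1 ^ (d - 1) * X 2 + (X 0 ^ d + X 0 ^ a * X 1 ^ b) := by
    rw [curveForm]; ring
  rw [h]
  apply irreducible_mul_X_add
  · exact pow_ne_zero _ (X_ne_zero _)
  · intro h
    have := vars_pow _ _ h
    simp [vars_X] at this
  · classical
    intro h
    have := vars_add_subset _ _ h
    rw [Finset.mem_union] at this
    rcases this with h | h
    · have := vars_pow _ _ h
      simp [vars_X] at this
    · have := vars_mul _ _ h
      rw [Finset.mem_union] at this
      rcases this with h | h <;>
      · have := vars_pow _ _ h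
        simp [vars_X] at this
  · apply IsRelPrime.pow_left
    rw [X_prime.irreducible.isRelPrime_iff_not_dvd]
    intro h
    have := killY_of_X1_dvd h
    simp [show b ≠ 0 by omega] at this

theorem isReducedCurve_curveForm {a b d : ℕ} (hb : 1 ≤ b) (hd : a + b = d) :
    IsReducedCurve (curveForm a b d) :=
  ⟨⟨d, by omega, isHomogeneous_curveForm hb hd⟩, (irreducible_curveForm hb hd).squarefree⟩

/-- Off $y=0$ the equation determines $z$, so projection from $(0:0:1)$ inverts the parametrization.
The line $y=0$ meets the curve only in $(0:0:1)$, whose sole preimage is $(1:0)$. -/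
theorem isRationalCuspidal_curveForm {a b d : ℕ} (ha : 1 ≤ a) (hb : 1 ≤ b) (hd : a + b = d) :
    IsRationalCuspidal (curveForm a b d) := by
  refine ⟨⟨d, isHomogeneous_curveForm hb hd⟩, irreducible_curveForm hb hd, d,
    ![X 0 * X 1 ^ (d - 1), X 1 ^ d, -(X 0 ^ d + X 0 ^ a * X 1 ^ b)], ?_, ?_, ?_, ?_, ?_, ?_⟩
  · have h1 := (isHomogeneous_X ℂ (0 : Fin 2)).mul
      (isHomogeneous_X_pow (R := ℂ) (1 : Fin 2) (d - 1))
    have h2 := (isHomogeneous_X_pow (R := ℂ) (0 : Fin 2) a).mul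
      (isHomogeneous_X_pow (R := ℂ) (1 : Fin 2) b)
    rw [hd] at h2
    rw [show 1 + (d - 1) = d by omega] at h1
    intro i
    fin_cases i
    · exact h1
    · exact isHomogeneous_X_pow _ _
    · exact ((isHomogeneous_X_pow _ _).add h2).neg
  · intro s hs h
    apply hs
    have h1 : s 1 = 0 := by
      have := congrFun h 1
      simp [evalTriple] at this
      exact this.1
    have h2 : s 0 = 0 := by
      have := congrFun h 2
      simp [evalTriple, h1, show b ≠ 0 by omega] at this
      exact this.1
    ext i
    fin_cases i
    · exact h2
    · exact h1
  · intro s _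
    obtain ⟨e, rfl⟩ : ∃ e, d = e + 1 := ⟨d - 1, by omega⟩
    simp only [evalTriple, curveForm, map_add, map_mul, map_pow, eval_X, Matrix.cons_val,
      map_neg, Nat.add_sub_cancel, mul_pow]
    have h3 : (s 1 ^ e) ^ a * (s 1 ^ (e + 1)) ^ b = (s 1 ^ (e + 1)) ^ e * s 1 ^ b := by
      rw [← pow_mul, ← pow_mul, ← pow_mul, ← pow_add, ← pow_add, ← hd]
      congr 1
      nlinarith
    have h4 : (s 1 ^ e) ^ (e + 1) = (s 1 ^ (e + 1)) ^ e := by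
      rw [← pow_mul, ← pow_mul, mul_comm]
    linear_combination s 0 ^ a * h3 + s 0 ^ (e + 1) * h4
  · intro v hv h
    by_cases h1 : v 1 = 0
    · simp only [curveForm, map_add, map_mul, map_pow, eval_X, h1] at h
      rw [zero_pow (by omega), zero_pow (by omega), mul_zero, zero_mul, add_zero, add_zero] at h
      have h0 : v 0 = 0 := by simpa [show d ≠ 0 by omega] using h
      have h2 : v 2 ≠ 0 := by
        intro h2
        apply hv
        ext i
        fin_cases i <;> assumption
      refine ⟨![1, 0], by simp, -(v 2)⁻¹, ?_⟩
      ext i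
      fin_cases i
      · simp [evalTriple, h0, show d - 1 ≠ 0 by omega]
      · simp [evalTriple, h1, show d ≠ 0 by omega]
      · simp [evalTriple, h2, show b ≠ 0 by omega]
    · refine ⟨![v 0, v 1], ?_, v 1 ^ (d - 1), ?_⟩
      · intro h'
        exact h1 (congrFun h' 1)
      · simp only [curveForm, map_add, map_mul, map_pow, eval_X] at h
        ext i
        fin_cases i
        · simp [evalTriple, mul_comm]
        · simp [evalTriple, ← pow_succ, show d - 1 + 1 = d by omega]
        · simp [evalTriple]
          linear_combination -h
  · rintro s t hs ht ⟨c, hc⟩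
    obtain ⟨e, rfl⟩ : ∃ e, d = e + 1 := ⟨d - 1, by omega⟩
    have h0 := congrFun hc 0
    have h1 := congrFun hc 1
    simp only [evalTriple, map_mul, map_pow, eval_X, Matrix.cons_val, Nat.add_sub_cancel,
      Pi.smul_apply, smul_eq_mul] at h0 h1
    have hne : ∀ u : Fin 2 → ℂ, u ≠ 0 → u 1 = 0 → u 0 ≠ 0 := by
      intro u hu h h'
      apply hu
      ext i
      fin_cases i <;> assumption
    by_cases ht1 : t 1 = 0
    · have hs1 : s 1 = 0 := by simpa [ht1] using h1
      refine ⟨s 0 / t 0, ?_⟩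
      ext i
      fin_cases i
      · have := hne t ht ht1
        simp [this]
      · simp [ht1, hs1]
    · refine ⟨s 1 / t 1, ?_⟩
      -- Otherwise $c=0$, so the third entry $-s_0^d$ vanishes as well and $s=0$.
      have hs1 : s 1 ≠ 0 := by
        intro hs1
        have hc0 : c = 0 := by simpa [hs1, ht1] using h1
        have h2 := congrFun hc 2
        simp [evalTriple, hs1, hc0, show b ≠ 0 by omega] at h2
        exact hne s hs hs1 h2
      ext i
      fin_cases i
      · have : s 0 * t 1 = s 1 * t 0 := by
          apply mul_left_cancel₀ (mul_ne_zero (pow_ne_zero e hs1) (pow_ne_zero e ht1))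
          linear_combination t 1 ^ (e + 1) * h0 - t 0 * t 1 ^ e * h1
        simp only [Fin.zero_eta, Pi.smul_apply, smul_eq_mul]
        field_simp
        exact this
      · simp [ht1]
  · refine ⟨1, ![X 0, X 1], ?_, ⟨1, ?_⟩, ?_⟩
    · intro j
      fin_cases j <;> exact isHomogeneous_X _ _
    · simp
    · obtain ⟨e, rfl⟩ : ∃ e, d = e + 1 := ⟨d - 1, by omega⟩
      simp
      ring

/-! ### The gradient and the Jacobian syzygies. -/

/-- The partial derivatives of `f` have the shape of those of `curveForm (a + 1) (b + 1) d`. -/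
structure HasTrinomialGradient (f : S) (a b : ℕ) (q ν μ s : ℂ) : Prop where
  q_ne : q ≠ 0
  ν_ne : ν ≠ 0
  μ_ne : μ ≠ 0
  s_ne : s ≠ 0
  pderiv_x : pderiv 0 f = C q * C ν * C μ * X 0 ^ (a + b + 1) + C q * X 0 ^ a * X 1 ^ (b + 1)
  pderiv_y : pderiv 1 f = X 1 ^ b * (C q * C ν * X 0 ^ (a + 1) + C s * X 1 ^ a * X 2)
  pderiv_z : pderiv 2 f = X 1 ^ b * X 1 ^ (a + 1)

/-- Exponents are shifted by one to avoid truncated subtraction. The ratios `μ` and `ν` are the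
multipliers that cancel the top powers of $x$ in the first and second divisions. -/
theorem hasTrinomialGradient_curveForm (a b : ℕ) :
    HasTrinomialGradient (curveForm (a + 1) (b + 1) (a + b + 2)) a b (a + 1)
      ((b + 1) / (a + 1)) ((a + b + 2) / (b + 1)) (a + b + 1) := by
  have h1 : (a + 1 : ℂ) ≠ 0 := by exact_mod_cast Nat.succ_ne_zero a
  have h2 : (b + 1 : ℂ) ≠ 0 := by exact_mod_cast Nat.succ_ne_zero b
  have h3 : (a + b + 2 : ℂ) ≠ 0 := by exact_mod_cast Nat.succ_ne_zero (a + b + 1)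
  have h4 : (a + b + 1 : ℂ) ≠ 0 := by exact_mod_cast Nat.succ_ne_zero (a + b)
  refine ⟨h1, div_ne_zero h2 h1, div_ne_zero h3 h2, h4, ?_, ?_, ?_⟩
  · rw [← C_mul, mul_div_cancel₀ _ h1, ← C_mul, mul_div_cancel₀ _ h2]
    simp [curveForm, map_ofNat]
    ring
  · rw [← C_mul, mul_div_cancel₀ _ h1]
    simp [curveForm]
    ring
  · simp [curveForm]
    ring

theorem mem_syzygies {f : S} {r : Fin 3 → S} :
    r ∈ syzygies f ↔ r 0 * pderiv 0 f + r 1 * pderiv 1 f + r 2 * pderiv 2 f = 0 := by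
  rw [syzygies, LinearMap.mem_ker, gradientMap, Fintype.linearCombination_apply,
    Fin.sum_univ_three]
  simp

/-- A Jacobian syzygy is determined by its first two entries if `f_z ≠ 0`. -/
theorem syzygy_ext {f : S} (hz : pderiv 2 f ≠ 0) {r r' : Fin 3 → S} (hr : r ∈ syzygies f)
    (hr' : r' ∈ syzygies f) (h0 : r 0 = r' 0) (h1 : r 1 = r' 1) : r = r' := by
  rw [mem_syzygies] at hr hr'
  have h2 : r 2 = r' 2 := by
    apply mul_right_cancel₀ hz
    linear_combination hr - hr' - pderiv 0 f * h0 - pderiv 1 f * h1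
  ext1 i
  fin_cases i <;> assumption

theorem isHomogeneous_term (c : ℂ) {i j k l : ℕ} (h : i + j + k = l) :
    (C c * X 0 ^ i * X 1 ^ j * X 2 ^ k : S).IsHomogeneous l := by
  have := (((isHomogeneous_X_pow (R := ℂ) (0 : Fin 3) i).C_mul c).mul
    (isHomogeneous_X_pow (1 : Fin 3) j)).mul (isHomogeneous_X_pow (2 : Fin 3) k)
  rwa [h] at this

namespace HasTrinomialGradient

variable {f : S} {a b : ℕ} {q ν μ s : ℂ}

theorem pderiv_z_ne (h : HasTrinomialGradient f a b q ν μ s) : pderiv 2 f ≠ 0 := by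
  rw [h.pderiv_z]
  exact mul_ne_zero (pow_ne_zero _ (X_ne_zero _)) (pow_ne_zero _ (X_ne_zero _))

theorem killY_pderiv_x (h : HasTrinomialGradient f a b q ν μ s) :
    killY (pderiv 0 f) = C (q * ν * μ) * X 0 ^ (a + b + 1) := by
  rw [h.pderiv_x]
  simp

/-- The first entry of a Jacobian syzygy is divisible by `yᵇ`. -/
theorem exists_syzygy_zero (h : HasTrinomialGradient f a b q ν μ s) {r : Fin 3 → S}
    (hr : r ∈ syzygies f) : ∃ p, r 0 = X 1 ^ b * p ∧
      p * pderiv 0 f + r 1 * (C q * C ν * X 0 ^ (a + 1) + C s * X 1 ^ a * X 2)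
        + r 2 * X 1 ^ (a + 1) = 0 := by
  rw [mem_syzygies] at hr
  obtain ⟨p, hp⟩ : (X 1 : S) ^ b ∣ r 0 := by
    apply X1_pow_dvd_of_mul (F := pderiv 0 f)
    · rw [h.killY_pderiv_x]
      exact C_mul_X0_pow_ne_zero (mul_ne_zero (mul_ne_zero h.q_ne h.ν_ne) h.μ_ne) _
    · rw [h.pderiv_y, h.pderiv_z] at hr
      exact ⟨-(r 1 * (C q * C ν * X 0 ^ (a + 1) + C s * X 1 ^ a * X 2)
        + r 2 * X 1 ^ (a + 1)), by linear_combination hr⟩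
  refine ⟨p, hp, ?_⟩
  apply mul_left_cancel₀ (pow_ne_zero b (X_ne_zero (1 : Fin 3)) : (X 1 : S) ^ b ≠ 0)
  rw [h.pderiv_y, h.pderiv_z] at hr
  linear_combination hr - pderiv 0 f * hp

/-! ### The free case. -/

/-- The module of Jacobian syzygies has a basis of two triples which is triangular, with the
multiple `C q * C ν * y ^ (a + 2 + e)` of a power of `y` and `y ^ (a + 2)` as pivots. -/
theorem isFreeWithExponents (hf : IsReducedCurve f) {e : ℕ}
    (h : HasTrinomialGradient f (a + 1) (a + 2 + e) q ν μ s) :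
    IsFreeWithExponents f (a + 2) (a + 2 + e) := by
  set g : S := C q * C ν * X 0 ^ (a + 2) + C s * X 1 ^ (a + 1) * X 2 with hg
  set r₀ : Fin 3 → S := ![0, X 1 ^ (a + 2), -g] with hr₀
  -- This writes $q\nu f_x$ as an element of $(g, y^{a+2})$: the product of $g$ with its conjugate
  -- $q\nu x^{a+2}-sy^{a+1}z$ is a multiple of $x^{2a+4}$ modulo $y^{2a+2}$, and the second term of
  -- $f_x$ is divisible by $y^{a+3+e}$.
  set r₁ : Fin 3 → S := ![C q * C ν * X 1 ^ (a + 2 + e),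
    -(C μ * X 0 ^ e * (C q * C ν * X 0 ^ (a + 2) - C s * X 1 ^ (a + 1) * X 2)),
    -(C μ * C s ^ 2 * X 0 ^ e * X 1 ^ a * X 2 ^ 2
      + C q ^ 2 * C ν * X 0 ^ (a + 1) * X 1 ^ (e + 1))] with hr₁
  have hm₀ : r₀ ∈ syzygies f := by
    rw [mem_syzygies, h.pderiv_y, h.pderiv_z]
    simp [hr₀, hg]
    ring
  have hm₁ : r₁ ∈ syzygies f := by
    rw [mem_syzygies, h.pderiv_x, h.pderiv_y, h.pderiv_z]
    simp [hr₁]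
    ring
  have hqν : (C (q * ν) : S) ≠ 0 := by simp [h.q_ne, h.ν_ne]
  have hinv : (C (q * ν)⁻¹ * (C q * C ν) : S) = 1 := by
    rw [← C_mul, ← C_mul, inv_mul_cancel₀ (mul_ne_zero h.q_ne h.ν_ne), C_1]
  have hli : LinearIndependent S ![(⟨r₀, hm₀⟩ : syzygies f), ⟨r₁, hm₁⟩] := by
    rw [LinearIndependent.pair_iff]
    intro u v huv
    have huv' : u • r₀ + v • r₁ = 0 := congrArg Subtype.val huv
    have h0 := congrFun huv' 0
    have h1 := congrFun huv' 1
    have hv : v = 0 := by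
      rw [C_mul] at hqν
      simpa [hr₀, hr₁, h.q_ne, h.ν_ne] using h0
    refine ⟨?_, hv⟩
    simpa [hr₀, hr₁, hv] using h1
  have hspan : ⊤ ≤ Submodule.span S (Set.range ![(⟨r₀, hm₀⟩ : syzygies f), ⟨r₁, hm₁⟩]) := by
    rintro ⟨r, hr⟩ -
    obtain ⟨p, hp, -⟩ := h.exists_syzygy_zero hr
    set t : S := C (q * ν)⁻¹ * p with ht
    have hr' : r - t • r₁ ∈ syzygies f := sub_mem hr (Submodule.smul_mem _ _ hm₁)
    have h0 : (r - t • r₁) 0 = 0 := by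
      simp only [Pi.sub_apply, Pi.smul_apply, smul_eq_mul, hp, hr₁, Matrix.cons_val_zero, ht]
      linear_combination -X 1 ^ (a + 2 + e) * p * hinv
    obtain ⟨u, hu⟩ : (X 1 : S) ^ (a + 2) ∣ (r - t • r₁) 1 := by
      rw [mem_syzygies, h0, h.pderiv_y, h.pderiv_z] at hr'
      apply X1_pow_dvd_of_mul (F := g)
      · rw [hg]
        simp [h.q_ne, h.ν_ne]
      · refine ⟨-(r - t • r₁) 2, ?_⟩
        apply mul_left_cancel₀
          (pow_ne_zero (a + 2 + e) (X_ne_zero (1 : Fin 3)) : (X 1 : S) ^ (a + 2 + e) ≠ 0)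
        linear_combination hr'
    have hru : r - t • r₁ = u • r₀ := by
      refine syzygy_ext h.pderiv_z_ne hr' (Submodule.smul_mem _ _ hm₀) ?_ ?_
      · rw [h0]
        simp [hr₀]
      · rw [hu]
        simp [hr₀, mul_comm]
    have : (⟨r, hr⟩ : syzygies f) = u • ⟨r₀, hm₀⟩ + t • ⟨r₁, hm₁⟩ := by
      apply Subtype.ext
      change r = u • r₀ + t • r₁
      rw [← hru, sub_add_cancel]
    rw [this]
    exact add_mem (Submodule.smul_mem _ _ (Submodule.subset_span ⟨0, rfl⟩))
      (Submodule.smul_mem _ _ (Submodule.subset_span ⟨1, rfl⟩))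
  refine ⟨hf, by omega, Module.Basis.mk hli hspan, ?_, ?_⟩
  · rw [Module.Basis.mk_apply]
    intro i
    change (r₀ i).IsHomogeneous (a + 2)
    fin_cases i
    · exact isHomogeneous_zero _ _ _
    · exact isHomogeneous_X_pow _ _
    · have h1 := isHomogeneous_term (-(q * ν)) (i := a + 2) (j := 0) (k := 0) (l := a + 2) (by ring)
      have h2 := isHomogeneous_term (-s) (i := 0) (j := a + 1) (k := 1) (l := a + 2) (by ring)
      convert h1.add h2 using 1
      simp [hr₀, hg]
      ring
  · rw [Module.Basis.mk_apply]
    intro i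
    change (r₁ i).IsHomogeneous (a + 2 + e)
    fin_cases i
    · convert isHomogeneous_term (q * ν) (i := 0) (j := a + 2 + e) (k := 0) (l := a + 2 + e)
        (by ring) using 1
      simp [hr₁]
    · convert (isHomogeneous_term (-(μ * q * ν)) (i := a + 2 + e) (j := 0) (k := 0)
        (l := a + 2 + e) (by ring)).add (isHomogeneous_term (μ * s) (i := e) (j := a + 1) (k := 1)
        (l := a + 2 + e) (by ring)) using 1
      simp [hr₁]
      ring
    · convert (isHomogeneous_term (-(μ * s ^ 2)) (i := e) (j := a) (k := 2)
        (l := a + 2 + e) (by ring)).add (isHomogeneous_term (-(q ^ 2 * ν)) (i := a + 1)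
        (j := e + 1) (k := 0) (l := a + 2 + e) (by ring)) using 1
      simp [hr₁]
      ring

end HasTrinomialGradient

/-! ### Tools for the nearly free cases. -/

theorem X1_pow_cancel {p p' : S} (m : ℕ) (h : X 1 ^ m * p = X 1 ^ m * p') : p = p' :=
  mul_left_cancel₀ (pow_ne_zero m (X_ne_zero (1 : Fin 3)) : (X 1 : S) ^ m ≠ 0) h

theorem X0_pow_cancel {p p' : S} (m : ℕ) (h : X 0 ^ m * p = X 0 ^ m * p') : p = p' :=
  mul_left_cancel₀ (pow_ne_zero m (X_ne_zero (0 : Fin 3)) : (X 0 : S) ^ m ≠ 0) h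

/-- If `f_z ≠ 0`, then a presentation of the module of Jacobian syzygies may be verified on the
first two entries. -/
theorem hasNearlyFreeExponents_of_entries {f : S} (hz : pderiv 2 f ≠ 0) {d₁ d₂ : ℕ} (h0 : 0 < d₁)
    (h12 : d₁ ≤ d₂) (r : Fin 3 → Fin 3 → S) (ρ : Fin 3 → S)
    (hr0 : IsHomogeneousTriple (r 0) d₁) (hr1 : IsHomogeneousTriple (r 1) d₂)
    (hr2 : IsHomogeneousTriple (r 2) d₂) (hρ0 : (ρ 0).IsHomogeneous (d₂ + 1 - d₁))
    (hρ1 : (ρ 1).IsHomogeneous 1) (hρ2 : (ρ 2).IsHomogeneous 1) (hρ : ρ 2 ≠ 0)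
    (hmem : ∀ j, r j ∈ syzygies f)
    (hgen : ∀ s ∈ syzygies f, ∃ c₀ c₁ c₂, s 0 = c₀ * r 0 0 + c₁ * r 1 0 + c₂ * r 2 0 ∧
      s 1 = c₀ * r 0 1 + c₁ * r 1 1 + c₂ * r 2 1)
    (hrel0 : ρ 0 * r 0 0 + ρ 1 * r 1 0 + ρ 2 * r 2 0 = 0)
    (hrel1 : ρ 0 * r 0 1 + ρ 1 * r 1 1 + ρ 2 * r 2 1 = 0)
    (hker : ∀ c₀ c₁ c₂, c₀ * r 0 0 + c₁ * r 1 0 + c₂ * r 2 0 = 0 →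
      c₀ * r 0 1 + c₁ * r 1 1 + c₂ * r 2 1 = 0 →
      ∃ t, c₀ = t * ρ 0 ∧ c₁ = t * ρ 1 ∧ c₂ = t * ρ 2) :
    HasNearlyFreeExponents f d₁ d₂ := by
  have hcomb : ∀ c : Fin 3 → S, Fintype.linearCombination S r c ∈ syzygies f := fun c => by
    rw [Fintype.linearCombination_apply]
    exact sum_mem fun j _ => Submodule.smul_mem _ _ (hmem j)
  have hentry : ∀ (c : Fin 3 → S) i, Fintype.linearCombination S r c i
      = c 0 * r 0 i + c 1 * r 1 i + c 2 * r 2 i := fun c i => by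
    rw [Fintype.linearCombination_apply, Fin.sum_univ_three]
    simp
  refine ⟨h0, h12, r, ρ, hr0, hr1, hr2, ?_, hρ0, hρ1, hρ2, fun h => hρ (congrFun h 2), ?_⟩
  · apply le_antisymm
    · rw [Submodule.span_le]
      rintro _ ⟨j, rfl⟩
      exact hmem j
    · intro s hs
      obtain ⟨c₀, c₁, c₂, e0, e1⟩ := hgen s hs
      rw [Submodule.mem_span_range_iff_exists_fun]
      refine ⟨![c₀, c₁, c₂], ?_⟩
      rw [← Fintype.linearCombination_apply]
      refine syzygy_ext hz (hcomb _) hs ?_ ?_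
      · rw [hentry, e0]
        simp
      · rw [hentry, e1]
        simp
  · apply le_antisymm
    · intro c hc
      rw [LinearMap.mem_ker] at hc
      obtain ⟨t, ht⟩ := hker (c 0) (c 1) (c 2) (by rw [← hentry, hc]; rfl)
        (by rw [← hentry, hc]; rfl)
      rw [Submodule.mem_span_singleton]
      refine ⟨t, ?_⟩
      ext1 i
      fin_cases i
      · exact ht.1.symm
      · exact ht.2.1.symm
      · exact ht.2.2.symm
    · rw [Submodule.span_singleton_le_iff_mem, LinearMap.mem_ker]
      refine syzygy_ext hz (hcomb _) (zero_mem _) ?_ ?_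
      · rw [hentry, hrel0]
        rfl
      · rw [hentry, hrel1]
        rfl

/-- The criterion `isNearlyFree_of_generator`, verified in an ideal linked to the Jacobian
ideal. -/
theorem isNearlyFree_of_linked {f : S} (hf : IsReducedCurve f) {K : Ideal S} {m : ℕ}
    (h : Linked (jacobianIdeal f) K m) {w : S} {e : ℕ} (hw : w.IsHomogeneous e) (hwK : w ∉ K)
    (hy : X 1 * w ∈ K) (l : ℂ) (hz : (X 2 - C l * X 0) * w ∈ K) (j : ℕ) (hx : X 0 ^ j * w ∈ K)
    (hsat : ∀ n g, X 2 ^ n * g ∈ K → ∃ s, g - s * w ∈ K) : IsNearlyFree f := by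
  have hmul : ∀ s, s * w ∈ K → s * (X 1 ^ m * w) ∈ jacobianIdeal f := fun s hs => by
    rw [mul_left_comm]
    exact (h.1 _).2 hs
  refine isNearlyFree_of_generator hf ((isHomogeneous_X_pow (R := ℂ) (1 : Fin 3) m).mul hw)
    (fun h' => hwK ((h.1 _).1 h')) (hmul _ hy) l (hmul _ hz) j (hmul _ hx) fun n g hg => ?_
  obtain ⟨u, hu⟩ := h.2 n g hg
  have h1 : X 2 ^ n * u ∈ K := by
    rw [← h.1]
    have := Ideal.sub_mem _ hg (Ideal.mul_mem_left _ (X 2 ^ n) hu)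
    convert this using 1
    ring
  obtain ⟨s, hs⟩ := hsat n u h1
  refine ⟨s, ?_⟩
  have := Ideal.add_mem _ hu ((h.1 _).2 hs)
  convert this using 1
  ring

theorem C_inv_mul {c : ℂ} (hc : c ≠ 0) : (C c⁻¹ * C c : S) = 1 := by
  rw [← C_mul, inv_mul_cancel₀ hc, C_1]

namespace HasTrinomialGradient

variable {f : S} {a b : ℕ} {q ν μ s : ℂ}

/-- One division: $y^b$ is removed from $f_y$ and $f_z$, then $f_x$ is replaced by $y^mF$ modulo $g$
and $y^m$ is removed. The condition `ha` makes the $z$-term of $g$ vanish at $y=0$. -/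
theorem linked_of_pderiv_x_eq (h : HasTrinomialGradient f a b q ν μ s) {F u : S} {m n : ℕ}
    (hmn : m + n = a + 1)
    (hF : pderiv 0 f = u * (C q * C ν * X 0 ^ (a + 1) + C s * X 1 ^ a * X 2) + X 1 ^ m * F)
    (ha : a ≠ 0) :
    Linked (jacobianIdeal f)
      (Ideal.span {C q * C ν * X 0 ^ (a + 1) + C s * X 1 ^ a * X 2, F, X 1 ^ n}) (b + m) := by
  set g : S := C q * C ν * X 0 ^ (a + 1) + C s * X 1 ^ a * X 2 with hg
  have h1 := linked_span (mul_ne_zero (mul_ne_zero h.q_ne h.ν_ne) h.μ_ne) h.killY_pderiv_x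
    g (X 1 ^ (a + 1)) b
  rw [← h.pderiv_y, ← h.pderiv_z, ← jacobianIdeal_eq] at h1
  have hkg : killY g = C (q * ν) * X 0 ^ (a + 1) := by
    simp [hg, ha]
  have h2 := linked_span (mul_ne_zero h.q_ne h.ν_ne) hkg F (X 1 ^ n) m
  have h3 : Ideal.span {pderiv 0 f, g, X 1 ^ (a + 1)}
      = Ideal.span {g, X 1 ^ m * F, X 1 ^ m * X 1 ^ n} := by
    ext v
    rw [mem_span_three, mem_span_three, hF, ← pow_add, hmn]
    constructor
    · rintro ⟨α, β, γ, rfl⟩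
      exact ⟨α * u + β, α, γ, by ring⟩
    · rintro ⟨α, β, γ, rfl⟩
      exact ⟨β, α - β * u, γ, by ring⟩
  rw [h3] at h1
  exact h1.trans h2

/-! ### One division: $b\le a\le b+1$ in the original exponents. -/

section Balanced

variable {i : ℕ} {l : S} {ε : ℂ}

/-- The form `l` is $y$ if $b=a+1$ and $x$ if $b=a$, so that one computation serves both. -/
theorem pderiv_x_eq_of_balanced (h : HasTrinomialGradient f (a + 1) b q ν μ s)
    (hl : X 0 ^ (a + 1) * X 1 ^ (b + 1) = X 0 ^ b * X 1 ^ (a + 1) * l) :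
    pderiv 0 f = C μ * X 0 ^ b * (C q * C ν * X 0 ^ (a + 2) + C s * X 1 ^ (a + 1) * X 2)
      + X 1 ^ (a + 1) * (X 0 ^ b * (C q * l - C μ * C s * X 2)) := by
  rw [h.pderiv_x]
  linear_combination C q * hl

/-- Modulo $y$, the linked ideal is generated by $x^{a+2}$ and $x^b(q\varepsilon x-\mu sz)$. Both
are divisible by $x^b$, which generates the torsion; the second one dictates the linear form killing
it. -/
theorem isNearlyFree_of_balanced (hf : IsReducedCurve f)
    (h : HasTrinomialGradient f (a + 1) b q ν μ s) (hi : b + i = a + 1)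
    (hl : X 0 ^ (a + 1) * X 1 ^ (b + 1) = X 0 ^ b * X 1 ^ (a + 1) * l)
    (hkl : killY l = C ε * X 0) : IsNearlyFree f := by
  have hlink := h.linked_of_pderiv_x_eq (n := 1) (by ring) (h.pderiv_x_eq_of_balanced hl)
    (Nat.succ_ne_zero a)
  obtain ⟨v, hv⟩ := exists_eq_killY_add l
  rw [hkl] at hv
  have hμs := C_inv_mul (mul_ne_zero h.μ_ne h.s_ne)
  have hqν := C_inv_mul (mul_ne_zero h.q_ne h.ν_ne)
  rw [C_mul] at hμs hqν
  have hx : (X 0 : S) ^ b * X 0 ^ (i + 1) = X 0 ^ (a + 1 + 1) := by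
    rw [← pow_add, ← add_assoc, hi]
  refine isNearlyFree_of_linked hf hlink (isHomogeneous_X_pow 0 b) (fun hmem => ?_) ?_
    ((μ * s)⁻¹ * (q * ε)) ?_ (i + 1) ?_ fun n g hg => ?_
  · obtain ⟨α, β, γ, e⟩ := mem_span_three.1 hmem
    have e1 := congrArg killY e
    simp only [map_mul, map_add, map_sub, map_pow, killY_X0, killY_X1, killY_X2, killY_C, hkl]
      at e1
    have e2 : (1 : S) = killY α * (C q * C ν * X 0 ^ (i + 1))
        + killY β * (C q * (C ε * X 0) - C μ * C s * X 2) := by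
      apply X0_pow_cancel b
      linear_combination e1 - killY α * C q * C ν * hx
    -- At the origin the right side vanishes.
    have e3 := congrArg (eval (0 : Fin 3 → ℂ)) e2
    simp at e3
  · exact mem_span_three.2 ⟨0, 0, X 0 ^ b, by ring⟩
  · refine mem_span_three.2 ⟨0, -C (μ * s)⁻¹, C (μ * s)⁻¹ * C q * v * X 0 ^ b, ?_⟩
    simp only [C_mul]
    linear_combination X 0 ^ b * C (μ * s)⁻¹ * C q * hv - X 0 ^ b * X 2 * hμs
  · refine mem_span_three.2 ⟨C (q * ν)⁻¹, 0, -C (q * ν)⁻¹ * C s * X 1 ^ a * X 2, ?_⟩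
    linear_combination hx - X 0 ^ (a + 2) * hqν
  · obtain ⟨α, β, γ, e⟩ := mem_span_three.1 hg
    have e1 := congrArg killY e
    simp only [map_mul, map_add, map_sub, map_pow, killY_X0, killY_X1, killY_X2, killY_C, hkl]
      at e1
    obtain ⟨t, ht⟩ : (X 0 : S) ^ b ∣ killY g := by
      refine X0_pow_dvd_of_mul (X0_not_dvd_X2_pow n) ⟨killY α * (C q * C ν * X 0 ^ (i + 1))
        + killY β * (C q * (C ε * X 0) - C μ * C s * X 2), ?_⟩
      linear_combination e1 - killY α * C q * C ν * hx
    obtain ⟨u, hu⟩ := exists_eq_killY_add g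
    exact ⟨t, mem_span_three.2 ⟨0, 0, u, by linear_combination hu + ht⟩⟩

/-- With $p=r_0/y^b$ and $q_2=(r_1+\mu x^bp)/y^{a+1}$, a syzygy becomes $p\,x^bA+q_2g+r_2y=0$.
Modulo $y$, the pair $(p,q_2)$ is a multiple of $(q\nu x^{i+1},-A)$. -/
theorem hasNearlyFreeExponents_of_balanced
    (h : HasTrinomialGradient f (a + 1) b q ν μ s) (hi : b + i = a + 1)
    (hl : X 0 ^ (a + 1) * X 1 ^ (b + 1) = X 0 ^ b * X 1 ^ (a + 1) * l)
    (hkl : killY l = C ε * X 0) (hl1 : l.IsHomogeneous 1) :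
    HasNearlyFreeExponents f (b + 1) (a + 2) := by
  set A : S := C q * l - C μ * C s * X 2 with hA
  set g : S := C q * C ν * X 0 ^ (a + 2) + C s * X 1 ^ (a + 1) * X 2 with hg
  have hfx : pderiv 0 f = C μ * X 0 ^ b * g + X 1 ^ (a + 1) * (X 0 ^ b * A) :=
    h.pderiv_x_eq_of_balanced hl
  have hfy : pderiv 1 f = X 1 ^ b * g := h.pderiv_y
  have hx : (X 0 : S) ^ b * X 0 ^ (i + 1) = X 0 ^ (a + 2) := by
    rw [← pow_add, ← add_assoc, hi]
  have hA1 : A.IsHomogeneous 1 := by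
    have h1 := (hl1.C_mul q).add (isHomogeneous_term (-(μ * s)) (i := 0) (j := 0) (k := 1) (l := 1)
      (by ring))
    convert h1 using 1
    simp [hA]
    ring
  have hkA : killY A = C q * (C ε * X 0) - C μ * C s * X 2 := by
    simp [hA, hkl]
  have hkA0 : ¬ (X 0 : S) ∣ killY A := by
    rw [hkA]
    rintro ⟨t, ht⟩
    have := congrArg (eval (![0, 0, 1] : Fin 3 → ℂ)) ht
    simp [h.μ_ne, h.s_ne] at this
  have hg1 : g.IsHomogeneous (a + 2) := by
    have h1 := isHomogeneous_term (q * ν) (i := a + 2) (j := 0) (k := 0) (l := a + 2) (by ring)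
    have h2 := isHomogeneous_term s (i := 0) (j := a + 1) (k := 1) (l := a + 2) (by ring)
    convert h1.add h2 using 1
    simp [hg]
  have hkg : killY g = C q * C ν * X 0 ^ (a + 2) := by
    simp [hg]
  have hkg0 : killY g ≠ 0 := by
    rw [hkg, ← C_mul]
    exact C_mul_X0_pow_ne_zero (mul_ne_zero h.q_ne h.ν_ne) _
  have hqν := C_inv_mul (mul_ne_zero h.q_ne h.ν_ne)
  rw [C_mul] at hqν
  -- The rows have $(p,q_2)$ equal to $(y,0)$, $(0,y)$ and $(-q\nu x^{i+1},A)$; the relation between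
  -- these pairs is `ρ`.
  refine hasNearlyFreeExponents_of_entries h.pderiv_z_ne (Nat.succ_pos b) (by omega)
    ![![X 1 ^ (b + 1), -(C μ * X 0 ^ b * X 1), -(X 0 ^ b * A)],
      ![0, X 1 ^ (a + 2), -g],
      ![-(C q * C ν * X 0 ^ (i + 1) * X 1 ^ b),
        X 1 ^ (a + 1) * A + C μ * C q * C ν * X 0 ^ (a + 2), -(C s * X 1 ^ a * X 2 * A)]]
    ![C q * C ν * X 0 ^ (i + 1), -A, X 1] ?_ ?_ ?_ ?_ ?_ ?_ ?_ ?_ ?_ ?_ ?_ ?_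
  · intro j
    fin_cases j
    · exact isHomogeneous_X_pow _ _
    · have h1 := isHomogeneous_term μ (i := b) (j := 1) (k := 0) (l := b + 1) (by ring)
      rw [pow_zero, mul_one, pow_one] at h1
      exact h1.neg
    · exact ((isHomogeneous_X_pow _ _).mul hA1).neg
  · intro j
    fin_cases j
    · exact isHomogeneous_zero _ _ _
    · exact isHomogeneous_X_pow _ _
    · exact hg1.neg
  · intro j
    fin_cases j
    · have h1 := isHomogeneous_term (q * ν) (i := i + 1) (j := b) (k := 0) (l := a + 2) (by omega)
      rw [pow_zero, mul_one, C_mul] at h1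
      exact h1.neg
    · have h1 := isHomogeneous_term (μ * q * ν) (i := a + 2) (j := 0) (k := 0) (l := a + 2)
        (by ring)
      rw [pow_zero, mul_one, pow_zero, mul_one, C_mul, C_mul] at h1
      exact ((isHomogeneous_X_pow _ _).mul hA1).add h1
    · have h1 := isHomogeneous_term s (i := 0) (j := a) (k := 1) (l := a + 1) (by ring)
      rw [pow_zero, mul_one, pow_one] at h1
      exact (h1.mul hA1).neg
  · have h1 := isHomogeneous_term (q * ν) (i := i + 1) (j := 0) (k := 0) (l := a + 2 + 1 - (b + 1))
      (by omega)
    rw [pow_zero, mul_one, pow_zero, mul_one, C_mul] at h1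
    exact h1
  · exact hA1.neg
  · exact isHomogeneous_X _ _
  · exact X_ne_zero _
  · intro j
    rw [mem_syzygies, hfx, hfy, h.pderiv_z]
    fin_cases j
    · simp
      ring
    · simp
      ring
    · simp
      linear_combination -(C q * C ν * C μ * X 1 ^ b * g + C q * C ν * X 1 ^ (a + 1 + b) * A) * hx
        + X 1 ^ (a + 1 + b) * A * hg
  · intro r hr
    obtain ⟨p, hp, hpr⟩ := h.exists_syzygy_zero hr
    change p * pderiv 0 f + r 1 * g + _ = 0 at hpr
    rw [hfx] at hpr
    obtain ⟨q₂, hq₂⟩ : (X 1 : S) ^ (a + 1) ∣ r 1 + C μ * X 0 ^ b * p :=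
      X1_pow_dvd_of_mul hkg0 ⟨-(p * (X 0 ^ b * A) + r 2 * X 1), by linear_combination hpr⟩
    have h2 : p * (X 0 ^ b * A) + q₂ * g + r 2 * X 1 = 0 := by
      apply X1_pow_cancel (a + 1)
      linear_combination hpr - g * hq₂
    have h3 := congrArg killY h2
    simp only [map_add, map_mul, map_pow, killY_X0, killY_X1, hkg, map_zero, mul_zero,
      add_zero] at h3
    have h4 : killY p * killY A + killY q₂ * (C q * C ν * X 0 ^ (i + 1)) = 0 := by
      apply X0_pow_cancel b
      linear_combination h3 + killY q₂ * C q * C ν * hx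
    obtain ⟨t, ht⟩ : (X 0 : S) ^ (i + 1) ∣ killY p :=
      X0_pow_dvd_of_mul hkA0 ⟨-(killY q₂ * (C q * C ν)), by linear_combination h4⟩
    have h5 : t * killY A + killY q₂ * (C q * C ν) = 0 := by
      apply X0_pow_cancel (i + 1)
      linear_combination h4 - killY A * ht
    obtain ⟨u, hu⟩ := exists_eq_killY_add p
    obtain ⟨v, hv⟩ := exists_eq_killY_add q₂
    obtain ⟨A₁, hA₁⟩ := exists_eq_killY_add A
    have h6 : killY q₂ = -C (q * ν)⁻¹ * t * killY A := by
      linear_combination C (q * ν)⁻¹ * h5 - killY q₂ * hqν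
    have h7 : p = C q * C ν * X 0 ^ (i + 1) * (C (q * ν)⁻¹ * t) + X 1 * u := by
      linear_combination hu + ht - X 0 ^ (i + 1) * t * hqν
    refine ⟨u, v + A₁ * (C (q * ν)⁻¹ * t), -(C (q * ν)⁻¹ * t), ?_, ?_⟩
    · simp only [Matrix.cons_val]
      linear_combination hp + X 1 ^ b * h7
    · simp only [Matrix.cons_val]
      linear_combination hq₂ - C μ * X 0 ^ b * h7 + X 1 ^ (a + 1) * (hv + h6)
        + X 1 ^ (a + 1) * C (q * ν)⁻¹ * t * hA₁ - C μ * C q * C ν * C (q * ν)⁻¹ * t * hx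
  · simp
    ring
  · simp
    linear_combination -C q * C ν * C μ * X 1 * hx
  · intro c₀ c₁ c₂ e0 e1
    simp only [Matrix.cons_val] at e0 e1 ⊢
    have e2 : c₀ * X 1 = c₂ * (C q * C ν * X 0 ^ (i + 1)) := by
      apply X1_pow_cancel b
      linear_combination e0
    obtain ⟨t, rfl⟩ : (X 1 : S) ∣ c₂ := by
      have hdvd : (X 1 : S) ^ 1 ∣ c₂ := by
        refine X1_pow_dvd_of_mul (F := C q * C ν * X 0 ^ (i + 1)) ?_ ⟨c₀, by
          linear_combination -e2⟩
        simp [h.q_ne, h.ν_ne]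
      simpa using hdvd
    have e3 : c₀ = C q * C ν * X 0 ^ (i + 1) * t := by
      apply X1_pow_cancel 1
      linear_combination e2
    refine ⟨t, by rw [e3]; ring, ?_, by ring⟩
    apply X1_pow_cancel (a + 2)
    linear_combination e1 + C μ * X 0 ^ b * X 1 * e3 + C q * C ν * C μ * X 1 * t * hx

end Balanced

end HasTrinomialGradient

namespace HasTrinomialGradient

/-! ### Two divisions: $a\ge b+2$ in the original exponents. -/

section Unbalanced

variable {f : S} {b m : ℕ} {q ν μ s : ℂ}

theorem pderiv_x_eq_of_unbalanced (h : HasTrinomialGradient f (b + m + 2) b q ν μ s) :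
    pderiv 0 f = C μ * X 0 ^ b * (C q * C ν * X 0 ^ (b + m + 3) + C s * X 1 ^ (b + m + 2) * X 2)
      + X 1 ^ (b + 1) * (X 0 ^ b * (C q * X 0 ^ (m + 2) - C μ * C s * X 1 ^ (m + 1) * X 2)) := by
  rw [h.pderiv_x]
  ring

/-- The second division is $g=\nu xF+y^{m+1}G$. It ends at $(F,G,y)$, which modulo $y$ is generated
by $x^{b+m+2}$ and $x^{b+1}z$, so $x^{b+1}$ generates the torsion. -/
theorem isNearlyFree_of_unbalanced (hf : IsReducedCurve f)
    (h : HasTrinomialGradient f (b + m + 2) b q ν μ s) : IsNearlyFree f := by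
  have hlink := h.linked_of_pderiv_x_eq (n := m + 2) (by ring) h.pderiv_x_eq_of_unbalanced
    (Nat.succ_ne_zero _)
  set F : S := X 0 ^ b * (C q * X 0 ^ (m + 2) - C μ * C s * X 1 ^ (m + 1) * X 2) with hF
  set G : S := X 2 * (C ν * C μ * C s * X 0 ^ (b + 1) + C s * X 1 ^ (b + 1)) with hG
  have hkF : killY F = C q * X 0 ^ (b + m + 2) := by
    simp [hF]
    ring
  have hkG : killY G = X 2 * (C ν * C μ * C s * X 0 ^ (b + 1)) := by
    simp [hG]
  have hspan : Ideal.span {C q * C ν * X 0 ^ (b + m + 2 + 1) + C s * X 1 ^ (b + m + 2) * X 2, F,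
      X 1 ^ (m + 2)} = Ideal.span {F, X 1 ^ (m + 1) * G, X 1 ^ (m + 1) * X 1} := by
    have hg : (C q * C ν * X 0 ^ (b + m + 2 + 1) + C s * X 1 ^ (b + m + 2) * X 2 : S)
        = C ν * X 0 * F + X 1 ^ (m + 1) * G := by
      rw [hF, hG]
      ring
    ext v
    rw [mem_span_three, mem_span_three, hg]
    constructor
    · rintro ⟨α, β, γ, rfl⟩
      exact ⟨β + α * C ν * X 0, α, γ, by ring⟩
    · rintro ⟨α, β, γ, rfl⟩
      exact ⟨β, α - β * C ν * X 0, γ, by ring⟩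
  rw [hspan] at hlink
  have hlink' := hlink.trans (linked_span h.q_ne hkF G (X 1) (m + 1))
  have hq := C_inv_mul h.q_ne
  have hc := C_inv_mul (mul_ne_zero (mul_ne_zero h.ν_ne h.μ_ne) h.s_ne)
  rw [C_mul, C_mul] at hc
  refine isNearlyFree_of_linked hf hlink' (isHomogeneous_X_pow 0 (b + 1)) (fun hmem => ?_) ?_
    0 ?_ (m + 1) ?_ fun n g hg => ?_
  · obtain ⟨α, β, γ, e⟩ := mem_span_three.1 hmem
    have e1 := congrArg killY e
    simp only [map_mul, map_add, map_pow, killY_X0, killY_X1, hkF, hkG] at e1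
    have e2 : (1 : S) = killY α * (C q * X 0 ^ (m + 1))
        + killY β * (X 2 * (C ν * C μ * C s)) := by
      apply X0_pow_cancel (b + 1)
      linear_combination e1
    have e3 := congrArg (eval (0 : Fin 3 → ℂ)) e2
    simp at e3
  · exact mem_span_three.2 ⟨0, 0, X 0 ^ (b + 1), by ring⟩
  · refine mem_span_three.2 ⟨0, C (ν * μ * s)⁻¹,
      -C (ν * μ * s)⁻¹ * X 2 * C s * X 1 ^ b, ?_⟩
    rw [C_0, hG]
    linear_combination -X 0 ^ (b + 1) * X 2 * hc
  · refine mem_span_three.2 ⟨C q⁻¹, 0, C q⁻¹ * X 0 ^ b * C μ * C s * X 1 ^ m * X 2, ?_⟩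
    rw [hF]
    linear_combination -X 0 ^ (b + m + 2) * hq
  · obtain ⟨α, β, γ, e⟩ := mem_span_three.1 hg
    have e1 := congrArg killY e
    simp only [map_mul, map_add, map_pow, killY_X1, killY_X2, hkF, hkG] at e1
    obtain ⟨t, ht⟩ : (X 0 : S) ^ (b + 1) ∣ killY g := by
      refine X0_pow_dvd_of_mul (X0_not_dvd_X2_pow n) ⟨killY α * (C q * X 0 ^ (m + 1))
        + killY β * (X 2 * (C ν * C μ * C s)), ?_⟩
      linear_combination e1
    obtain ⟨u, hu⟩ := exists_eq_killY_add g
    exact ⟨t, mem_span_three.2 ⟨0, 0, u, by linear_combination hu + ht⟩⟩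

/-- With $p=r_0/y^b$, $q_2=(r_1+\mu x^bp)/y^{b+1}$ and $p_3=(p+\nu xq_2)/y^{m+1}$, a syzygy becomes
$p_3F+q_2G+r_2y=0$. -/
theorem hasNearlyFreeExponents_of_unbalanced
    (h : HasTrinomialGradient f (b + m + 2) b q ν μ s) :
    HasNearlyFreeExponents f (b + 2) (b + m + 2) := by
  set g : S := C q * C ν * X 0 ^ (b + m + 3) + C s * X 1 ^ (b + m + 2) * X 2 with hg
  set F : S := X 0 ^ b * (C q * X 0 ^ (m + 2) - C μ * C s * X 1 ^ (m + 1) * X 2) with hF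
  set G : S := X 2 * (C ν * C μ * C s * X 0 ^ (b + 1) + C s * X 1 ^ (b + 1)) with hG
  set P : S := -(C ν * C μ * C s * X 2 * X 1 ^ (m + 1)) - C q * C ν * X 0 ^ (m + 2) with hP
  have hfx : pderiv 0 f = C μ * X 0 ^ b * g + X 1 ^ (b + 1) * F := h.pderiv_x_eq_of_unbalanced
  have hfy : pderiv 1 f = X 1 ^ b * g := h.pderiv_y
  have hgFG : g = C ν * X 0 * F + X 1 ^ (m + 1) * G := by
    rw [hg, hF, hG]
    ring
  have hkF : killY F = C q * X 0 ^ (b + m + 2) := by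
    simp [hF]
    ring
  have hkG : killY G = X 2 * (C ν * C μ * C s * X 0 ^ (b + 1)) := by
    simp [hG]
  have hkP : killY P = -(C q * C ν * X 0 ^ (m + 2)) := by
    simp [hP]
  have hkg : killY g = C q * C ν * X 0 ^ (b + m + 3) := by
    simp [hg]
  have hF1 : F.IsHomogeneous (b + m + 2) := by
    convert (isHomogeneous_term q (i := b + m + 2) (j := 0) (k := 0) (l := b + m + 2)
      (by ring)).add (isHomogeneous_term (-(μ * s)) (i := b) (j := m + 1) (k := 1)
      (l := b + m + 2) (by ring)) using 1
    simp [hF]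
    ring
  have hG1 : G.IsHomogeneous (b + 2) := by
    convert (isHomogeneous_term (ν * μ * s) (i := b + 1) (j := 0) (k := 1) (l := b + 2)
      (by ring)).add (isHomogeneous_term s (i := 0) (j := b + 1) (k := 1)
      (l := b + 2) (by ring)) using 1
    simp [hG]
    ring
  have hP1 : P.IsHomogeneous (m + 2) := by
    convert (isHomogeneous_term (-(ν * μ * s)) (i := 0) (j := m + 1) (k := 1) (l := m + 2)
      (by ring)).add (isHomogeneous_term (-(q * ν)) (i := m + 2) (j := 0) (k := 0)
      (l := m + 2) (by ring)) using 1
    simp [hP]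
    ring
  -- The rows have $(p_3,q_2)$ equal to $(0,y)$, $(y,0)$ and $(-\nu\mu sz,\ qx^{m+1})$, the last
  -- being the syzygy of $F$ and $G$ modulo $y$; its first entry is $y^bP$.
  refine hasNearlyFreeExponents_of_entries h.pderiv_z_ne (Nat.succ_pos _) (by omega)
    ![![-(C ν * X 0 * X 1 ^ (b + 1)), X 1 ^ (b + 2) + C μ * C ν * X 0 ^ (b + 1) * X 1, -G],
      ![X 1 ^ (b + m + 2), -(C μ * X 0 ^ b * X 1 ^ (m + 2)), -F],
      ![X 1 ^ b * P, C q * X 0 ^ (m + 1) * X 1 ^ (b + 1) + C (-μ) * X 0 ^ b * P,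
        C (-(ν * μ ^ 2 * s ^ 2)) * X 0 ^ b * X 1 ^ m * X 2 ^ 2
          + C (-(q * s)) * X 0 ^ (m + 1) * X 1 ^ b * X 2 ^ 1]]
    ![C q * X 0 ^ (m + 1), -(C ν * C μ * C s * X 2), -X 1] ?_ ?_ ?_ ?_ ?_ ?_ ?_ ?_ ?_ ?_ ?_ ?_
  · intro j
    fin_cases j
    · have h1 := isHomogeneous_term ν (i := 1) (j := b + 1) (k := 0) (l := b + 2) (by ring)
      rw [pow_zero, mul_one, pow_one] at h1
      exact h1.neg
    · have h1 := isHomogeneous_term (μ * ν) (i := b + 1) (j := 1) (k := 0) (l := b + 2) (by ring)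
      rw [pow_zero, mul_one, pow_one, C_mul] at h1
      exact (isHomogeneous_X_pow _ _).add h1
    · exact hG1.neg
  · intro j
    fin_cases j
    · exact isHomogeneous_X_pow _ _
    · have h1 := isHomogeneous_term μ (i := b) (j := m + 2) (k := 0) (l := b + m + 2) (by ring)
      rw [pow_zero, mul_one] at h1
      exact h1.neg
    · exact hF1.neg
  · intro j
    fin_cases j
    · exact (isHomogeneous_X_pow _ _).mul hP1
    · have h1 := isHomogeneous_term q (i := m + 1) (j := b + 1) (k := 0) (l := b + m + 2) (by ring)
      rw [pow_zero, mul_one] at h1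
      exact h1.add (((isHomogeneous_X_pow _ _).C_mul _).mul hP1)
    · exact (isHomogeneous_term _ (by ring)).add (isHomogeneous_term _ (by ring))
  · have h1 := (isHomogeneous_X_pow (R := ℂ) (0 : Fin 3) (m + 1)).C_mul q
    rwa [show m + 1 = b + m + 2 + 1 - (b + 2) by omega] at h1 ⊢
  · have h1 := (isHomogeneous_X ℂ (2 : Fin 3)).C_mul (ν * μ * s)
    rw [C_mul, C_mul] at h1
    exact h1.neg
  · exact (isHomogeneous_X _ _).neg
  · exact neg_ne_zero.2 (X_ne_zero _)
  · intro j
    rw [mem_syzygies, hfx, hfy, h.pderiv_z]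
    fin_cases j
    · simp
      linear_combination X 1 ^ (b + b + 2) * hgFG
    · simp
      ring
    · simp
      rw [hgFG, hP, hF, hG]
      ring
  · intro r hr
    obtain ⟨p, hp, hpr⟩ := h.exists_syzygy_zero hr
    change p * pderiv 0 f + r 1 * g + _ = 0 at hpr
    rw [hfx] at hpr
    obtain ⟨q₂, hq₂⟩ : (X 1 : S) ^ (b + 1) ∣ r 1 + C μ * X 0 ^ b * p := by
      refine X1_pow_dvd_of_mul (F := g) ?_ ⟨-(p * F + r 2 * X 1 ^ (m + 2)), by
        linear_combination hpr⟩
      rw [hkg, ← C_mul]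
      exact C_mul_X0_pow_ne_zero (mul_ne_zero h.q_ne h.ν_ne) _
    have h2 : p * F + q₂ * g + r 2 * X 1 ^ (m + 2) = 0 := by
      apply X1_pow_cancel (b + 1)
      linear_combination hpr - g * hq₂
    rw [hgFG] at h2
    obtain ⟨p₃, hp₃⟩ : (X 1 : S) ^ (m + 1) ∣ p + C ν * X 0 * q₂ := by
      refine X1_pow_dvd_of_mul (F := F) ?_ ⟨-(q₂ * G + r 2 * X 1), by linear_combination h2⟩
      rw [hkF]
      exact C_mul_X0_pow_ne_zero h.q_ne _
    have h3 : p₃ * F + q₂ * G + r 2 * X 1 = 0 := by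
      apply X1_pow_cancel (m + 1)
      linear_combination h2 - F * hp₃
    have h4 := congrArg killY h3
    simp only [map_add, map_mul, killY_X1, hkF, hkG, map_zero, mul_zero, add_zero] at h4
    have h5 : killY p₃ * (C q * X 0 ^ (m + 1)) + killY q₂ * (C ν * C μ * C s * X 2) = 0 := by
      apply X0_pow_cancel (b + 1)
      linear_combination h4
    have hq := C_inv_mul h.q_ne
    have hc := C_inv_mul (mul_ne_zero (mul_ne_zero h.ν_ne h.μ_ne) h.s_ne)
    rw [C_mul, C_mul] at hc
    obtain ⟨t, ht⟩ : (X 0 : S) ^ (m + 1) ∣ killY q₂ := by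
      have hX2 := X0_not_dvd_X2_pow 1
      rw [pow_one] at hX2
      refine X0_pow_dvd_of_mul hX2 ⟨-(C (ν * μ * s)⁻¹ * killY p₃ * C q), ?_⟩
      linear_combination C (ν * μ * s)⁻¹ * h5 - killY q₂ * X 2 * hc
    have h6 : killY p₃ * C q + t * (C ν * C μ * C s * X 2) = 0 := by
      apply X0_pow_cancel (m + 1)
      linear_combination h5 - C ν * C μ * C s * X 2 * ht
    obtain ⟨u, hu⟩ := exists_eq_killY_add p₃
    obtain ⟨v, hv⟩ := exists_eq_killY_add q₂
    have h7 : p₃ = -(C ν * C μ * C s * X 2) * (C q⁻¹ * t) + X 1 * u := by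
      linear_combination hu + C q⁻¹ * h6 - killY p₃ * hq
    have h8 : q₂ = C q * X 0 ^ (m + 1) * (C q⁻¹ * t) + X 1 * v := by
      linear_combination hv + ht - X 0 ^ (m + 1) * t * hq
    have h9 : p = X 1 ^ (m + 2) * u - C ν * X 0 * X 1 * v + P * (C q⁻¹ * t) := by
      rw [hP]
      linear_combination hp₃ + X 1 ^ (m + 1) * h7 - C ν * X 0 * h8
    refine ⟨v, u, C q⁻¹ * t, ?_, ?_⟩
    · simp only [Matrix.cons_val]
      linear_combination hp + X 1 ^ b * h9
    · simp only [Matrix.cons_val, C_neg]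
      linear_combination hq₂ + X 1 ^ (b + 1) * h8 - C μ * X 0 ^ b * h9
  · simp [hP]
    ring
  · simp [hP]
    ring
  · intro c₀ c₁ c₂ e0 e1
    simp only [Matrix.cons_val, C_neg] at e0 e1 ⊢
    have e2 : -(C ν * X 0 * X 1 * c₀) + X 1 ^ (m + 2) * c₁ + P * c₂ = 0 := by
      apply X1_pow_cancel b
      linear_combination e0
    have e3 : X 1 * c₀ + C q * X 0 ^ (m + 1) * c₂ = 0 := by
      apply X1_pow_cancel (b + 1)
      linear_combination e1 + C μ * X 0 ^ b * e2
    obtain ⟨t, rfl⟩ : (X 1 : S) ∣ c₂ := by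
      have hdvd : (X 1 : S) ^ 1 ∣ c₂ := by
        refine X1_pow_dvd_of_mul (F := C q * X 0 ^ (m + 1)) ?_ ⟨-c₀, by
          linear_combination e3⟩
        simp [h.q_ne]
      simpa using hdvd
    have e4 : c₀ = -(C q * X 0 ^ (m + 1) * t) := by
      apply X1_pow_cancel 1
      linear_combination e3
    refine ⟨-t, by rw [e4]; ring, ?_, by ring⟩
    apply X1_pow_cancel (m + 2)
    rw [hP] at e2
    linear_combination e2 + C ν * X 0 * X 1 * e4

end Unbalanced

end HasTrinomialGradient

end PlaneCurve

end

/-! ### The main theorem. -/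

open PlaneCurve in
theorem corollary3p3 (a b d : ℕ) (ha : 2 ≤ a) (hb : 1 ≤ b) (hd : a + b = d) :
    PlaneCurve.IsRationalCuspidal (PlaneCurve.curveForm a b d) ∧
    (a < b → PlaneCurve.IsFreeWithExponents (PlaneCurve.curveForm a b d) a (b - 1)) ∧
    (b ≤ a → PlaneCurve.IsNearlyFree (PlaneCurve.curveForm a b d)) ∧
    (b + 2 ≤ a →
      PlaneCurve.IsNearlyFreeWithExponents (PlaneCurve.curveForm a b d) (b + 1) (a - 1)) ∧
    (b ≤ a → a ≤ b + 1 →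
      PlaneCurve.IsNearlyFreeWithExponents (PlaneCurve.curveForm a b d) b a) := by
  have hred := isReducedCurve_curveForm hb hd
  have hbal : b ≤ a → a ≤ b + 1 → IsNearlyFreeWithExponents (curveForm a b d) b a := by
    intro h1 h2
    obtain ⟨a, rfl⟩ : ∃ a', a = a' + 2 := ⟨a - 2, by omega⟩
    obtain ⟨b, rfl⟩ : ∃ b', b = b' + 1 := ⟨b - 1, by omega⟩
    obtain rfl : d = a + 1 + b + 2 := by omega
    have hgrad := hasTrinomialGradient_curveForm (a + 1) b
    -- After the shifts, $b=a+1$ is the original case $a=b$, and $b=a$ is the original $a=b+1$.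
    obtain rfl | rfl : b = a + 1 ∨ b = a := by omega
    · have hl : (X 0 ^ (a + 1) * X 1 ^ (a + 1 + 1) : S)
          = X 0 ^ (a + 1) * X 1 ^ (a + 1) * X 1 := by ring
      have hk : killY (X 1) = C 0 * X 0 := by simp
      exact ⟨hgrad.isNearlyFree_of_balanced hred (i := 0) rfl hl hk,
        hgrad.hasNearlyFreeExponents_of_balanced (i := 0) rfl hl hk (isHomogeneous_X _ _)⟩
    · have hl : (X 0 ^ (b + 1) * X 1 ^ (b + 1) : S)
          = X 0 ^ b * X 1 ^ (b + 1) * X 0 := by ring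
      have hk : killY (X 0) = C 1 * X 0 := by simp
      exact ⟨hgrad.isNearlyFree_of_balanced hred (i := 1) rfl hl hk,
        hgrad.hasNearlyFreeExponents_of_balanced (i := 1) rfl hl hk (isHomogeneous_X _ _)⟩
  have hunbal : b + 2 ≤ a →
      IsNearlyFreeWithExponents (curveForm a b d) (b + 1) (a - 1) := by
    intro h1
    obtain ⟨b, rfl⟩ : ∃ b', b = b' + 1 := ⟨b - 1, by omega⟩
    obtain ⟨m, rfl⟩ : ∃ m, a = b + m + 2 + 1 := ⟨a - b - 3, by omega⟩
    obtain rfl : d = b + m + 2 + b + 2 := by omega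
    have hgrad := hasTrinomialGradient_curveForm (b + m + 2) b
    exact ⟨hgrad.isNearlyFree_of_unbalanced hred, hgrad.hasNearlyFreeExponents_of_unbalanced⟩
  refine ⟨isRationalCuspidal_curveForm (by omega) hb hd, fun h => ?_, fun h => ?_, hunbal, hbal⟩
  · obtain ⟨a, rfl⟩ : ∃ a', a = a' + 2 := ⟨a - 2, by omega⟩
    obtain ⟨e, rfl⟩ : ∃ e, b = a + 2 + e + 1 := ⟨b - a - 3, by omega⟩
    obtain rfl : d = a + 1 + (a + 2 + e) + 2 := by omega
    exact (hasTrinomialGradient_curveForm (a + 1) (a + 2 + e)).isFreeWithExponents hred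
  · rcases le_or_gt a (b + 1) with h' | h'
    · exact (hbal h h').1
    · exact (hunbal h').1
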